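/- Let $1<p<\infty$ and let $\Omega\subset\mathbb{R}^2$ be a domain (a nonempty, open, connected set) of finite Lebesgue measure. Let $u=(u^1,u^2)\in W^{1,p}(\Omega,\mathbb{R}^2)$ be a $p$-harmonic mapping, i.e. a weak solution of the system $$\operatorname{div}\big(|Du|^{p-2}\nabla u^i\big)=0\quad\text{in }\Omega,\qquad i=1,2,$$ where $|Du|^2=|\nabla u^1|^2+|\nabla u^2|^2$; that is, $\int_\Omega |Du|^{p-2}\langle\nabla u^i,\nabla\varphi\rangle\,dx=0$ for all $\varphi\in C_c^\infty(\Omega)$ and $i=1,2$ (with $|Du|^{p-2}\nabla u^i:=0$ where $Du=0$). For $v\in W^{1,p}(\Omega,\mathbb{R})$ and $l\in\mathbb{R}$, say that $v\le l$ on $\partial\Omega$ if there is a sequence $(v_n)$ of Lipschitz functions on $\overline\Omega$ such that $v_n(x)\le l$ for every $x\in\partial\Omega$ and every $n$, and $\|v-v_n\|_{W^{1,p}(\Omega,\mathbb{R})}\to0$ as $n\to\infty$. If for some $i\in\{1,2\}$ and some $k\in\mathbb{R}$ we have $u^i\le k$ on $\partial\Omega$ in this sense, then $u^i\le k$ almost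 everywhere in $\Omega$. -/

import Mathlib

open MeasureTheory Filter Topology
open scoped Gradient ContDiff

/-- The Euclidean plane `ℝ²`. -/
abbrev Plane : Type := EuclideanSpace ℝ (Fin 2)

/-- `φ ∈ C_c^∞(Ω)`: a smooth real function with compact support contained in `Ω`. -/
def IsTestFunction (Ω : Set Plane) (φ : Plane → ℝ) : Prop :=
  ContDiff ℝ ∞ φ ∧ HasCompactSupport φ ∧ tsupport φ ⊆ Ω

/-- `G` is the weak (distributional) gradient of `v` in the open set `Ω`. -/
def HasWeakGradient (Ω : Set Plane) (v : Plane → ℝ) (G : Plane → Plane) : Prop :=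
  LocallyIntegrableOn v Ω volume ∧ LocallyIntegrableOn G Ω volume ∧
    ∀ φ : Plane → ℝ, IsTestFunction Ω φ →
      ∫ x in Ω, v x • ∇ φ x = -∫ x in Ω, φ x • G x

/-- `v ∈ W^{1,p}(Ω, ℝ)`. -/
def MemW1p (p : ℝ) (Ω : Set Plane) (v : Plane → ℝ) : Prop :=
  MemLp v (ENNReal.ofReal p) (volume.restrict Ω) ∧
    ∃ G : Plane → Plane,
      HasWeakGradient Ω v G ∧ MemLp G (ENNReal.ofReal p) (volume.restrict Ω)

/-- `u ∈ W^{1,p}(Ω, ℝ²)`. -/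
def MemW1pMap (p : ℝ) (Ω : Set Plane) (u : Plane → Plane) : Prop :=
  ∀ i : Fin 2, MemW1p p Ω (fun x => u x i)

/-- `v ∈ L^p_loc(Ω)`: the restriction of `v` to each compact subset of `Ω` is in `L^p`. -/
def MemLpLoc {F : Type*} [NormedAddCommGroup F] (p : ℝ) (Ω : Set Plane) (v : Plane → F) : Prop :=
  ∀ K : Set Plane, IsCompact K → K ⊆ Ω → MemLp v (ENNReal.ofReal p) (volume.restrict K)

/-- The norm `|Du| = (|∇u¹|² + |∇u²|²)^{1/2}` of the Jacobi matrix with rows `Du 0`, `Du 1`. -/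
noncomputable def jacobiNorm (Du : Fin 2 → Plane → Plane) (x : Plane) : ℝ :=
  Real.sqrt (‖Du 0 x‖ ^ 2 + ‖Du 1 x‖ ^ 2)

/-- `u ∈ W^{1,p}_loc(Ω, ℝ²)` is `p`-harmonic: a weak solution of
`div (|Du|^{p-2} ∇u^i) = 0`, `i = 1, 2`. Where `Du = 0`, the field `|Du|^{p-2} ∇u^i` is `0`,
whatever the value of the power. -/
def IsPHarmonicMap (p : ℝ) (Ω : Set Plane) (u : Plane → Plane) : Prop :=
  ∃ Du : Fin 2 → Plane → Plane,
    (∀ i, MemLpLoc p Ω (fun x => u x i) ∧ MemLpLoc p Ω (Du i) ∧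
      HasWeakGradient Ω (fun x => u x i) (Du i)) ∧
    ∀ i, ∀ φ : Plane → ℝ, IsTestFunction Ω φ →
      ∫ x in Ω, jacobiNorm Du x ^ (p - 2) * inner ℝ (Du i x) (∇ φ x) = 0

/-- `v ≤ l` on `∂Ω` in the Sobolev sense: there are functions `w n`, Lipschitz on the closure of
`Ω`, with `w n ≤ l` at every point of `∂Ω` and `‖v - w n‖_{W^{1,p}(Ω)} → 0`
(`H n` is the weak gradient of `v - w n`). -/
def SobolevBoundaryLE (p : ℝ) (Ω : Set Plane) (v : Plane → ℝ) (l : ℝ) : Prop :=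
  ∃ (w : ℕ → Plane → ℝ) (H : ℕ → Plane → Plane),
    (∀ n, ∃ L, LipschitzOnWith L (w n) (closure Ω)) ∧
    (∀ n, ∀ x ∈ frontier Ω, w n x ≤ l) ∧
    (∀ n, HasWeakGradient Ω (fun x => v x - w n x) (H n)) ∧
    Tendsto (fun n => eLpNorm (fun x => v x - w n x) (ENNReal.ofReal p) (volume.restrict Ω))
      atTop (𝓝 0) ∧
    Tendsto (fun n => eLpNorm (H n) (ENNReal.ofReal p) (volume.restrict Ω)) atTop (𝓝 0)

/-! Let `S` be `Real.smoothTransition`: smooth, nondecreasing, zero exactly on `(-∞, 0]`, with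
bounded derivative. For `δ > 0` the equation is tested with `g = S(u^i - k - δ)`, whose gradient is
`S'(u^i - k - δ) ∇u^i`. This gives `∫ |Du|^(p-2) S' |∇u^i|² = 0` with a nonnegative integrand, so
`∇g = 0` almost everywhere (where `Du = 0` this is automatic). The Sobolev inequality `‖g‖₂ ≤ C
‖∇g‖₁` then forces `g = 0`, that is `u^i ≤ k + δ`; finally `δ → 0`.

The work lies in showing that `g` is admissible. Only two facts about `g` are needed, orthogonality
to the field `A = |Du|^(p-2) ∇u^i` and the Sobolev inequality; `IsTestPair` records them, and
`IsTestPair.of_tendsto` carries them through limits. Two limits are taken: from test functions to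
`S(W - k - δ)` with `W` Lipschitz and `W ≤ k` on the boundary, by mollification and cutoff; then
from the Lipschitz approximants to `u^i`. The margin `δ` keeps the truncated mollifications away
from the boundary. -/

/-! ### Test pairs and their stability under limits -/

theorem tendsto_eLpNorm_sub_of_dominated {α E : Type*} [MeasurableSpace α] {μ : Measure α}
    [NormedAddCommGroup E] {p : ENNReal} (hp0 : p ≠ 0) (hp : p ≠ ⊤)
    {f : ℕ → α → E} {g : α → E} {b : α → ℝ} (hf : ∀ n, AEStronglyMeasurable (f n) μ)
    (hb : MemLp b p μ) (hfb : ∀ n, ∀ᵐ x ∂μ, ‖f n x‖ ≤ b x)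
    (h : ∀ᵐ x ∂μ, Tendsto (fun n => f n x) atTop (𝓝 (g x))) :
    Tendsto (fun n => eLpNorm (fun x => f n x - g x) p μ) atTop (𝓝 0) := by
  have hp' : 0 < p.toReal := ENNReal.toReal_pos hp0 hp
  have hg : AEStronglyMeasurable g μ := aestronglyMeasurable_of_tendsto_ae _ hf h
  have hgb : ∀ᵐ x ∂μ, ‖g x‖ ≤ b x := by
    filter_upwards [h, ae_all_iff.2 hfb] with x hx hxb
    exact le_of_tendsto hx.norm (Eventually.of_forall hxb)
  have key : Tendsto (fun n => ∫⁻ x, ‖f n x - g x‖ₑ ^ p.toReal ∂μ) atTop (𝓝 (∫⁻ _, 0 ∂μ)) := by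
    refine tendsto_lintegral_of_dominated_convergence' (fun x => ‖b x + b x‖ₑ ^ p.toReal)
      (fun n => ((hf n).sub hg).enorm.pow_const _) (fun n => ?_) ?_ ?_
    · filter_upwards [hfb n, hgb] with x h1 h2
      gcongr
      rw [enorm_le_iff_norm_le]
      exact (norm_sub_le _ _).trans ((add_le_add h1 h2).trans (Real.le_norm_self _))
    · have := (hb.add hb).2
      rw [eLpNorm_lt_top_iff_lintegral_rpow_enorm_lt_top hp0 hp] at this
      exact this.ne
    · filter_upwards [h] with x hx
      have h1 : Tendsto (fun n => ‖f n x - g x‖ₑ) atTop (𝓝 0) := by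
        have := (hx.sub_const (g x)).enorm
        simpa using this
      have := (ENNReal.continuous_rpow_const (y := p.toReal)).tendsto 0 |>.comp h1
      simpa [Function.comp_def, ENNReal.zero_rpow_of_pos hp'] using this
  have h2 := (ENNReal.continuous_rpow_const (y := 1 / p.toReal)).tendsto 0
  rw [ENNReal.zero_rpow_of_pos (by positivity)] at h2
  rw [lintegral_zero] at key
  refine (h2.comp key).congr fun n => ?_
  rw [eLpNorm_eq_lintegral_rpow_enorm_toReal hp0 hp]
  rfl

/-- The properties of a test function `g` with gradient `F` on `Ω` that survive passing to the limit:
`F` is orthogonal to the field `A`, and the Sobolev inequality holds. -/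
def IsTestPair (Ω : Set Plane) (A : Plane → Plane) (g : Plane → ℝ) (F : Plane → Plane) : Prop :=
  ∫ x in Ω, inner ℝ (A x) (F x) = 0 ∧
    eLpNorm g 2 (volume.restrict Ω) ≤
      eLpNormLESNormFDerivOneConst (volume : Measure Plane) 2 * eLpNorm F 1 (volume.restrict Ω)

theorem norm_gradient_eq_norm_fderiv (φ : Plane → ℝ) (x : Plane) : ‖∇ φ x‖ = ‖fderiv ℝ φ x‖ := by
  rw [← toDual_gradient, LinearIsometryEquiv.norm_map]

theorem IsTestFunction.continuous_gradient {Ω : Set Plane} {φ : Plane → ℝ}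
    (hφ : IsTestFunction Ω φ) : Continuous (∇ φ) :=
  (InnerProductSpace.toDual ℝ Plane).symm.continuous.comp (hφ.1.continuous_fderiv (by simp))

/-- Gagliardo–Nirenberg–Sobolev on the plane: in dimension 2 the exponent 1 is paired with 2. The
gradient vanishes off `Ω`, so its norm over the plane is its norm over `Ω`. -/
theorem IsTestFunction.isTestPair {Ω : Set Plane} {A : Plane → Plane}
    {φ : Plane → ℝ} (hφ : IsTestFunction Ω φ) (hA : ∫ x in Ω, inner ℝ (A x) (∇ φ x) = 0) :
    IsTestPair Ω A φ (∇ φ) := by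
  refine ⟨hA, ?_⟩
  have hc : NNReal.HolderConjugate (Module.finrank ℝ Plane) 2 := by
    rw [finrank_euclideanSpace_fin]
    exact_mod_cast NNReal.HolderConjugate.two_two
  have h := eLpNorm_le_eLpNorm_fderiv_one (volume : Measure Plane)
    (hφ.1.of_le (by exact_mod_cast le_top)) hφ.2.1 hc
  rw [NNReal.coe_ofNat] at h
  refine (eLpNorm_mono_measure _ Measure.restrict_le_self).trans (h.trans ?_)
  refine mul_le_mul_right ?_ _
  have h1 : eLpNorm (fderiv ℝ φ) 1 volume = eLpNorm (∇ φ) 1 volume :=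
    eLpNorm_congr_norm_ae (Eventually.of_forall fun x => (norm_gradient_eq_norm_fderiv φ x).symm)
  rw [h1, ← eLpNorm_restrict_eq_of_support_subset (s := Ω)]
  intro x hx
  by_contra hxΩ
  apply hx
  have : fderiv ℝ φ x = 0 := by
    by_contra hne
    exact hxΩ (hφ.2.2 (support_fderiv_subset ℝ hne))
  rw [← norm_eq_zero, norm_gradient_eq_norm_fderiv, this, norm_zero]

theorem tendsto_eLpNorm_of_tendsto_eLpNorm_sub {α E : Type*} [MeasurableSpace α] {μ : Measure α}
    [NormedAddCommGroup E] {p : ENNReal} (hp1 : 1 ≤ p) {F : ℕ → α → E} {G : α → E}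
    (hF : ∀ n, AEStronglyMeasurable (F n) μ) (hG : MemLp G p μ)
    (h : Tendsto (fun n => eLpNorm (fun x => F n x - G x) p μ) atTop (𝓝 0)) :
    Tendsto (fun n => eLpNorm (F n) p μ) atTop (𝓝 (eLpNorm G p μ)) := by
  have hu : Tendsto (fun n => eLpNorm G p μ + eLpNorm (fun x => F n x - G x) p μ) atTop
      (𝓝 (eLpNorm G p μ)) := by simpa using h.const_add (eLpNorm G p μ)
  have hl : Tendsto (fun n => eLpNorm G p μ - eLpNorm (fun x => F n x - G x) p μ) atTop
      (𝓝 (eLpNorm G p μ)) := by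
    simpa using ENNReal.Tendsto.sub (tendsto_const_nhds (x := eLpNorm G p μ)) h
      (Or.inl hG.2.ne)
  refine tendsto_of_tendsto_of_tendsto_of_le_of_le hl hu (fun n => ?_) (fun n => ?_)
  · refine tsub_le_iff_right.2 ?_
    have := eLpNorm_sub_le (hF n) ((hF n).sub hG.1) hp1
    rw [sub_sub_cancel] at this
    exact this
  · have := eLpNorm_add_le hG.1 ((hF n).sub hG.1) hp1
    rw [add_sub_cancel] at this
    exact this

theorem MeasureTheory.MemLp.integrable_real_inner {α E : Type*} [MeasurableSpace α] {μ : Measure α}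
    [NormedAddCommGroup E] [InnerProductSpace ℝ E] {p q : ENNReal} [ENNReal.HolderTriple q p 1]
    {A X : α → E} (hA : MemLp A q μ) (hX : MemLp X p μ) :
    Integrable (fun x => inner ℝ (A x) (X x)) μ :=
  memLp_one_iff_integrable.1 (MemLp.of_bilin (p := q) (q := p) (r := 1) (inner ℝ) 1 hA hX
    (hA.1.inner hX.1) (Eventually.of_forall fun x => by
      simpa using nnnorm_inner_le_nnnorm (𝕜 := ℝ) (A x) _))

/-- Orthogonality survives by Hölder, since `A` lies in the dual space. In the Sobolev inequality
the left side is handled by Fatou, so pointwise convergence of `g` suffices; on the right, `L^p`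
convergence gives `L^1` convergence because `Ω` has finite measure. -/
theorem IsTestPair.of_tendsto {Ω : Set Plane} (hΩ : volume Ω < ⊤) {p q : ENNReal} (hp : 1 ≤ p)
    [ENNReal.HolderTriple q p 1] {A : Plane → Plane} (hA : MemLp A q (volume.restrict Ω))
    {g : ℕ → Plane → ℝ} {F : ℕ → Plane → Plane} {g' : Plane → ℝ} {F' : Plane → Plane}
    (h : ∀ n, IsTestPair Ω A (g n) (F n))
    (hg : ∀ n, AEStronglyMeasurable (g n) (volume.restrict Ω))
    (hF : ∀ n, MemLp (F n) p (volume.restrict Ω)) (hF' : MemLp F' p (volume.restrict Ω))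
    (hgg : ∀ᵐ x ∂(volume.restrict Ω), Tendsto (fun n => g n x) atTop (𝓝 (g' x)))
    (hFF : Tendsto (fun n => eLpNorm (fun x => F n x - F' x) p (volume.restrict Ω))
      atTop (𝓝 0)) :
    IsTestPair Ω A g' F' := by
  have : IsFiniteMeasure (volume.restrict Ω) := ⟨by simpa using hΩ⟩
  have hb : ∀ {X : Plane → Plane}, MemLp X p (volume.restrict Ω) →
      Integrable (fun x => inner ℝ (A x) (X x)) (volume.restrict Ω) := hA.integrable_real_inner
  constructor
  · have h0 : Tendsto (fun n => ∫ x in Ω, inner ℝ (A x) (F n x)) atTop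
        (𝓝 (∫ x in Ω, inner ℝ (A x) (F' x))) := by
      refine tendsto_integral_of_L1 _ (hb hF').1 (Eventually.of_forall fun n => hb (hF n)) ?_
      have h1 := ENNReal.Tendsto.const_mul hFF (Or.inr hA.2.ne)
      rw [mul_zero] at h1
      refine tendsto_of_tendsto_of_tendsto_of_le_of_le tendsto_const_nhds h1
        (fun n => zero_le) (fun n => ?_)
      have h2 := eLpNorm_le_eLpNorm_mul_eLpNorm'_of_norm (p := q) (q := p) (r := 1) hA.1 ((hF n).1.sub hF'.1)
        (inner ℝ) 1 (Eventually.of_forall fun x => by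
          simpa using norm_inner_le_norm (𝕜 := ℝ) (A x) (F n x - F' x))
      rw [eLpNorm_one_eq_lintegral_enorm] at h2
      simp only [Pi.sub_apply, inner_sub_right, ENNReal.coe_one, one_mul] at h2
      exact h2
    simp only [(h _).1] at h0
    exact (tendsto_nhds_unique h0 tendsto_const_nhds)
  · refine (Lp.eLpNorm_lim_le_liminf_eLpNorm hg g' hgg).trans ?_
    have hone : Tendsto (fun n => eLpNorm (fun x => F n x - F' x) 1 (volume.restrict Ω)) atTop
        (𝓝 0) := by
      have hfin : (volume.restrict Ω) Set.univ ^ (1 / (1 : ENNReal).toReal - 1 / p.toReal) ≠ ⊤ := by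
        refine ENNReal.rpow_ne_top_of_nonneg ?_ (measure_ne_top _ _)
        rcases eq_or_ne p ⊤ with rfl | hpt
        · simp
        · have : 1 ≤ p.toReal := by simpa using ENNReal.toReal_mono hpt hp
          simpa using inv_le_one_of_one_le₀ this
      have h1 := ENNReal.Tendsto.mul_const hFF (Or.inr hfin)
      rw [zero_mul] at h1
      exact tendsto_of_tendsto_of_tendsto_of_le_of_le tendsto_const_nhds h1
        (fun n => zero_le)
        (fun n => eLpNorm_le_eLpNorm_mul_rpow_measure_univ hp ((hF n).1.sub hF'.1))
    have h1 := tendsto_eLpNorm_of_tendsto_eLpNorm_sub le_rfl (fun n => (hF n).1)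
      (hF'.mono_exponent hp) hone
    have h2 := ENNReal.Tendsto.const_mul
      (a := (eLpNormLESNormFDerivOneConst (volume : Measure Plane) 2 : ENNReal)) h1
      (Or.inr ENNReal.coe_ne_top)
    rw [← h2.liminf_eq]
    exact liminf_le_liminf (Eventually.of_forall fun n => (h n).2)

/-! ### Mollification -/

open scoped Convolution

/-- The kernel is a probability density, so the mollification is an average of translates of `W`. -/
theorem LipschitzWith.normed_convolution {W : Plane → ℝ} {L : NNReal} (hW : LipschitzWith L W)
    (ρ : ContDiffBump (0 : Plane)) :
    LipschitzWith L (ρ.normed volume ⋆[ContinuousLinearMap.lsmul ℝ ℝ, volume] W) := by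
  have hi : ∀ x, Integrable (fun t => ρ.normed volume t • W (x - t)) volume := fun x =>
    ((ρ.continuous_normed (μ := volume)).smul
      (hW.continuous.comp (continuous_sub_left x))).integrable_of_hasCompactSupport
      (ρ.hasCompactSupport_normed (μ := volume)).smul_right
  refine LipschitzWith.of_dist_le_mul fun x y => ?_
  have h1 : ∀ z, (ρ.normed volume ⋆[ContinuousLinearMap.lsmul ℝ ℝ, volume] W) z =
      ∫ t, ρ.normed volume t • W (z - t) := fun z => rfl
  rw [dist_eq_norm, h1, h1, ← integral_sub (hi x) (hi y)]
  have h2 : ∫ t, ρ.normed volume t * (L * dist x y) = L * dist x y := by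
    rw [integral_mul_const, ρ.integral_normed, one_mul]
  rw [← h2]
  refine norm_integral_le_of_norm_le (ρ.integrable_normed.mul_const _)
    (Eventually.of_forall fun t => ?_)
  rw [← smul_sub, norm_smul, Real.norm_of_nonneg (ρ.nonneg_normed t), ← dist_eq_norm]
  refine mul_le_mul_of_nonneg_left ?_ (ρ.nonneg_normed t)
  simpa using hW.dist_le_mul (x - t) (y - t)

theorem isTestFunction_normed_sub {Ω : Set Plane} {ρ : ContDiffBump (0 : Plane)} {x : Plane}
    (hx : Metric.closedBall x ρ.rOut ⊆ Ω) :
    IsTestFunction Ω (fun t => ρ.normed volume (x - t)) := by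
  have hs : Function.support (fun t => ρ.normed volume (x - t)) ⊆ Metric.closedBall x ρ.rOut := by
    intro t ht
    have : x - t ∈ Function.support (ρ.normed volume) := ht
    rw [ρ.support_normed_eq, mem_ball_zero_iff, ← dist_eq_norm, dist_comm] at this
    exact this.le
  exact ⟨ρ.contDiff_normed.comp (contDiff_const.sub contDiff_id),
    HasCompactSupport.of_support_subset_isCompact (isCompact_closedBall _ _) hs,
    (closure_minimal hs Metric.isClosed_closedBall).trans hx⟩

/-- The derivative falls on the kernel. As the closed ball lies in `Ω`, `t ↦ ρ(x - t)` is a test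
function, and the definition of weak gradient moves the derivative onto `W`; the two minus signs
cancel. -/
theorem gradient_normed_convolution {Ω : Set Plane} (hΩ : MeasurableSet Ω) {W : Plane → ℝ}
    {G : Plane → Plane}
    (hW : Continuous W) (hG : HasWeakGradient Ω W G) {ρ : ContDiffBump (0 : Plane)} {x : Plane}
    (hx : Metric.closedBall x ρ.rOut ⊆ Ω) :
    ∇ (ρ.normed volume ⋆[ContinuousLinearMap.lsmul ℝ ℝ, volume] W) x =
      (ρ.normed volume ⋆[ContinuousLinearMap.lsmul ℝ ℝ, volume] Ω.indicator G) x := by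
  have hθ := isTestFunction_normed_sub hx
  have hd := HasCompactSupport.hasFDerivAt_convolution_left (ContinuousLinearMap.lsmul ℝ ℝ)
    (ρ.hasCompactSupport_normed (μ := volume)) (ρ.contDiff_normed (n := 1))
    (hW.locallyIntegrable (μ := volume)) x
  have hgrad : ∀ t, ∇ (fun t => ρ.normed volume (x - t)) t = -∇ (ρ.normed volume) (x - t) := by
    intro t
    have h1 : HasFDerivAt (ρ.normed volume) (fderiv ℝ (ρ.normed volume) (x - t)) (x - t) :=
      ((ρ.contDiff_normed (n := 1)).differentiable (by simp) _).hasFDerivAt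
    have h2 := h1.comp t ((hasFDerivAt_id t).const_sub x)
    have h3 := (hasFDerivAt_iff_hasGradientAt.1 h2).gradient
    change ∇ (ρ.normed volume ∘ fun t => x - t) t = _
    change ∇ (ρ.normed volume ∘ fun t => x - t) t = _ at h3
    rw [h3, gradient, ← map_neg]
    congr 1
    ext v
    simp
  have hi := (HasCompactSupport.convolutionExists_left
    ((ContinuousLinearMap.lsmul ℝ ℝ).precompL Plane)
    ((ρ.hasCompactSupport_normed (μ := volume)).fderiv ℝ)
    ((ρ.contDiff_normed (n := 1)).continuous_fderiv (by simp))
    (hW.locallyIntegrable (μ := volume)) x).integrable_swap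
  -- The inverse Riesz map is typed as conjugate-linear; this is its real-linear form, which
  -- commutes with the integral.
  let T := (InnerProductSpace.toDual ℝ Plane).symm.toLinearEquiv.toAddMonoidHom.toRealLinearMap
    (InnerProductSpace.toDual ℝ Plane).symm.continuous
  have hT := T.integral_comp_comm hi
  rw [(hasFDerivAt_iff_hasGradientAt.1 hd).gradient, convolution_eq_swap, convolution_eq_swap]
  refine hT.symm.trans ?_
  change ∫ t, (InnerProductSpace.toDual ℝ Plane).symm
      (((ContinuousLinearMap.lsmul ℝ ℝ).precompL Plane)
        (fderiv ℝ (ρ.normed volume) (x - t)) (W t)) = _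
  have h1 : ∀ t, (InnerProductSpace.toDual ℝ Plane).symm
      (((ContinuousLinearMap.lsmul ℝ ℝ).precompL Plane)
        (fderiv ℝ (ρ.normed volume) (x - t)) (W t)) =
      -(W t • ∇ (fun t => ρ.normed volume (x - t)) t) := by
    intro t
    rw [hgrad, smul_neg, neg_neg, gradient, ← LinearIsometryEquiv.map_smul]
    congr 1
    ext v
    simp [mul_comm]
  have h2 : ∀ t ∉ Ω, W t • ∇ (fun t => ρ.normed volume (x - t)) t = 0 := by
    intro t ht
    have : fderiv ℝ (fun t => ρ.normed volume (x - t)) t = 0 := by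
      by_contra hne
      exact ht (hθ.2.2 (support_fderiv_subset ℝ hne))
    rw [gradient, this]
    simp
  simp_rw [h1]
  rw [integral_neg, ← setIntegral_eq_integral_of_forall_compl_eq_zero h2, hG.2.2 _ hθ, neg_neg,
    ← integral_indicator hΩ]
  congr 1
  ext1 t
  by_cases ht : t ∈ Ω <;> simp [ht]

/-! ### Truncation and cutoff -/

/-- Near a boundary point `W < k + δ/2` by continuity, hence `f < k + δ` and the truncation
vanishes, so extension by zero is smooth. The indicator is needed because `W` may exceed `k` outside
`Ω`; the factor `χ` because `Ω` may be unbounded. -/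
theorem isTestFunction_indicator {Ω : Set Plane} (hΩ : IsOpen Ω) {W f χ : Plane → ℝ} {k δ : ℝ}
    (hδ : 0 < δ) (hW : Continuous W) (hWk : ∀ x ∈ frontier Ω, W x ≤ k) (hf : ContDiff ℝ ∞ f)
    (hfW : ∀ x, f x ≤ W x + δ / 2) (hχ : ContDiff ℝ ∞ χ) (hχc : HasCompactSupport χ) :
    IsTestFunction Ω
      (Ω.indicator fun x => χ x * Real.smoothTransition (f x - (k + δ))) := by
  set φ := Ω.indicator fun x => χ x * Real.smoothTransition (f x - (k + δ)) with hφ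
  have hin : ∀ x ∈ Ω, φ =ᶠ[𝓝 x] fun x => χ x * Real.smoothTransition (f x - (k + δ)) := by
    intro x hx
    filter_upwards [hΩ.mem_nhds hx] with y hy
    simp [hφ, hy]
  have hout : ∀ x ∉ Ω, φ =ᶠ[𝓝 x] 0 := by
    intro x hx
    by_cases hxc : x ∈ closure Ω
    · have hxf : x ∈ frontier Ω := by
        rw [hΩ.frontier_eq]
        exact ⟨hxc, hx⟩
      have : ∀ᶠ y in 𝓝 x, W y < k + δ / 2 :=
        hW.continuousAt.eventually_lt continuousAt_const (by linarith [hWk x hxf])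
      filter_upwards [this] with y hy
      by_cases hyΩ : y ∈ Ω
      · simp only [hφ, Set.indicator_of_mem hyΩ, Pi.zero_apply]
        rw [Real.smoothTransition.zero_of_nonpos (by linarith [hfW y]), mul_zero]
      · simp [hφ, hyΩ]
    · filter_upwards [isClosed_closure.isOpen_compl.mem_nhds hxc] with y hy
      have : y ∉ Ω := fun h => hy (subset_closure h)
      simp [hφ, this]
  refine ⟨?_, ?_, ?_⟩
  · rw [contDiff_iff_contDiffAt]
    intro x
    by_cases hx : x ∈ Ω
    · refine ContDiffAt.congr_of_eventuallyEq ?_ (hin x hx)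
      exact (hχ.mul (Real.smoothTransition.contDiff.comp (hf.sub contDiff_const))).contDiffAt
    · exact contDiffAt_const.congr_of_eventuallyEq (hout x hx)
  · refine hχc.mono fun x hx => ?_
    by_cases hxΩ : x ∈ Ω
    · rw [Function.mem_support, hφ, Set.indicator_of_mem hxΩ] at hx
      exact left_ne_zero_of_mul hx
    · exact absurd (by simp [hφ, hxΩ]) hx
  · intro x hx
    by_contra hxΩ
    exact (notMem_tsupport_iff_eventuallyEq.2 (hout x hxΩ)) hx

theorem exists_abs_deriv_smoothTransition_le :
    ∃ M : NNReal, ∀ t, ‖deriv Real.smoothTransition t‖ ≤ M := by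
  have hc : Continuous (deriv Real.smoothTransition) :=
    (Real.smoothTransition.contDiff (n := 1)).continuous_deriv le_rfl
  have hs : HasCompactSupport (deriv Real.smoothTransition) := by
    refine HasCompactSupport.of_support_subset_isCompact (isCompact_Icc (a := (0 : ℝ)) (b := 1)) ?_
    intro t ht
    by_contra h
    apply ht
    rw [Set.mem_Icc, not_and_or, not_le, not_le] at h
    rcases h with h | h
    · have : Real.smoothTransition =ᶠ[𝓝 t] fun _ => 0 := by
        filter_upwards [Iio_mem_nhds h] with s hs
        exact Real.smoothTransition.zero_of_nonpos (le_of_lt hs)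
      rw [this.deriv_eq, deriv_const]
    · have : Real.smoothTransition =ᶠ[𝓝 t] fun _ => 1 := by
        filter_upwards [Ioi_mem_nhds h] with s hs
        exact Real.smoothTransition.one_of_one_le (le_of_lt hs)
      rw [this.deriv_eq, deriv_const]
  obtain ⟨C, hC⟩ := hc.bounded_above_of_compact_support hs
  exact ⟨⟨C, (norm_nonneg _).trans (hC 0)⟩, hC⟩

theorem hasGradientAt_smoothTransition_comp {f : Plane → ℝ} {x : Plane}
    (hf : DifferentiableAt ℝ f x) (c : ℝ) :
    HasGradientAt (fun x => Real.smoothTransition (f x - c))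
      (deriv Real.smoothTransition (f x - c) • ∇ f x) x := by
  have h1 : HasDerivAt Real.smoothTransition (deriv Real.smoothTransition (f x - c)) (f x - c) :=
    ((Real.smoothTransition.contDiff (n := 1)).differentiable (by simp) _).hasDerivAt
  have h2 := h1.comp_hasFDerivAt x (hf.hasFDerivAt.sub_const c)
  rw [hasGradientAt_iff_hasFDerivAt]
  rw [map_smulₛₗ, toDual_gradient]
  exact h2

/-- A sequence of smooth cutoff functions, equal to `1` on larger and larger balls, whose
gradients are uniformly bounded. -/
theorem exists_cutoff : ∃ (χ : ℕ → Plane → ℝ) (C : NNReal),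
    (∀ j, ContDiff ℝ ∞ (χ j)) ∧ (∀ j, HasCompactSupport (χ j)) ∧
    (∀ j x, ‖χ j x‖ ≤ 1) ∧ (∀ j, LipschitzWith C (χ j)) ∧
    ∀ x, ∀ᶠ j in atTop, χ j =ᶠ[𝓝 x] fun _ => 1 := by
  let η : ContDiffBump (0 : Plane) := ⟨1, 2, one_pos, one_lt_two⟩
  obtain ⟨C, hC⟩ := ContDiff.lipschitzWith_of_hasCompactSupport η.hasCompactSupport
    (η.contDiff (n := 1)) (by simp)
  have hpos : ∀ j : ℕ, (0 : ℝ) < ((j : ℝ) + 1)⁻¹ := fun j => by positivity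
  refine ⟨fun j x => η (((j : ℝ) + 1)⁻¹ • x), C, fun j => ?_, fun j => ?_, fun j x => ?_,
    fun j => ?_, fun x => ?_⟩
  · exact η.contDiff.comp (contDiff_const_smul _)
  · exact η.hasCompactSupport.comp_smul (hpos j).ne'
  · rw [Real.norm_of_nonneg η.nonneg]
    exact η.le_one
  · refine LipschitzWith.of_dist_le_mul fun x y => (hC.dist_le_mul _ _).trans ?_
    refine mul_le_mul_of_nonneg_left ?_ C.2
    rw [dist_smul₀, Real.norm_of_nonneg (hpos j).le]
    refine mul_le_of_le_one_left dist_nonneg (inv_le_one_of_one_le₀ ?_)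
    have : (0 : ℝ) ≤ j := j.cast_nonneg
    linarith
  · have h1 : Tendsto (fun j : ℕ => ((j : ℝ) + 1)) atTop atTop :=
      tendsto_atTop_add_const_right _ _ tendsto_natCast_atTop_atTop
    filter_upwards [h1.eventually_gt_atTop ‖x‖] with j hj
    have : ∀ᶠ y in 𝓝 x, ‖y‖ < (j : ℝ) + 1 :=
      continuous_norm.continuousAt.eventually_lt continuousAt_const hj
    filter_upwards [this] with y hy
    refine η.one_of_mem_closedBall ?_
    rw [mem_closedBall_zero_iff, norm_smul, Real.norm_of_nonneg (hpos j).le]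
    change _ ≤ (1 : ℝ)
    rw [inv_mul_le_iff₀ (by positivity)]
    linarith

theorem memLp_deriv_smoothTransition_smul {μ : Measure Plane} {p : ENNReal} {v : Plane → ℝ}
    {G : Plane → Plane} (hv : AEStronglyMeasurable v μ) (hG : MemLp G p μ) (c : ℝ) :
    MemLp (fun x => deriv Real.smoothTransition (v x - c) • G x) p μ := by
  obtain ⟨M, hM⟩ := exists_abs_deriv_smoothTransition_le
  have hc : Continuous (deriv Real.smoothTransition) :=
    (Real.smoothTransition.contDiff (n := 1)).continuous_deriv le_rfl
  refine hG.of_le_mul (c := M) ((hc.comp_aestronglyMeasurable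
    (hv.sub aestronglyMeasurable_const)).smul hG.1) (Eventually.of_forall fun x => ?_)
  rw [norm_smul]
  exact mul_le_mul_of_nonneg_right (hM _) (norm_nonneg _)

/-- The approximants are `χ_j S(f_j - k - δ)` with `f_j` mollifications of `W`. Their gradients are
bounded by the constant `M L + C`, integrable to any power on a set of finite measure, and converge
at almost every point by Lebesgue differentiation of the weak gradient. Dominated convergence then
gives `L^p` convergence. -/
theorem LipschitzWith.isTestPair_smoothTransition {Ω : Set Plane} (hΩ : IsOpen Ω)
    (hΩv : volume Ω < ⊤) {p q : ENNReal} (hp : 1 ≤ p) (hp' : p ≠ ⊤)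
    [ENNReal.HolderTriple q p 1] {A : Plane → Plane} (hA : MemLp A q (volume.restrict Ω))
    (hAφ : ∀ φ, IsTestFunction Ω φ → ∫ x in Ω, inner ℝ (A x) (∇ φ x) = 0)
    {W : Plane → ℝ} {L : NNReal} (hW : LipschitzWith L W) {k : ℝ}
    (hWk : ∀ x ∈ frontier Ω, W x ≤ k) {G : Plane → Plane} (hG : HasWeakGradient Ω W G)
    (hGp : MemLp G p (volume.restrict Ω)) {δ : ℝ} (hδ : 0 < δ) :
    IsTestPair Ω A (fun x => Real.smoothTransition (W x - (k + δ)))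
      (fun x => deriv Real.smoothTransition (W x - (k + δ)) • G x) := by
  have hfin : IsFiniteMeasure (volume.restrict Ω) := ⟨by simpa using hΩv⟩
  obtain ⟨M, hM⟩ := exists_abs_deriv_smoothTransition_le
  obtain ⟨χ, C, hχ, hχc, hχ1, hχC, hχlim⟩ := exists_cutoff
  have hS' : Continuous (deriv Real.smoothTransition) :=
    (Real.smoothTransition.contDiff (n := 1)).continuous_deriv le_rfl
  -- Radii chosen so that mollifying moves `W` by at most `L * r j ≤ δ / 2`; the `+ 1` covers `L =
  -- 0`.
  let r : ℕ → ℝ := fun j => δ / (2 * (L + 1)) * (1 / ((j : ℝ) + 1))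
  have hL : (0 : ℝ) ≤ L := L.2
  have hr : ∀ j, 0 < r j := fun j => by positivity
  have hr0 : Tendsto r atTop (𝓝 0) := by
    simpa [r] using tendsto_one_div_add_atTop_nhds_zero_nat.const_mul (δ / (2 * ((L : ℝ) + 1)))
  have hrL : ∀ j, L * r j ≤ δ / 2 := by
    intro j
    have h1 : 1 / ((j : ℝ) + 1) ≤ 1 := by
      rw [div_le_one (by positivity)]
      have : (0 : ℝ) ≤ j := j.cast_nonneg
      linarith
    calc L * r j ≤ (L + 1) * (δ / (2 * (L + 1)) * 1) := by
          refine mul_le_mul (by linarith) ?_ (hr j).le (by positivity)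
          exact mul_le_mul_of_nonneg_left h1 (by positivity)
      _ = δ / 2 := by field_simp
  let ρ : ℕ → ContDiffBump (0 : Plane) := fun j => ⟨r j / 2, r j, half_pos (hr j),
    half_lt_self (hr j)⟩
  let f : ℕ → Plane → ℝ := fun j =>
    (ρ j).normed volume ⋆[ContinuousLinearMap.lsmul ℝ ℝ, volume] W
  have hfd : ∀ j x, dist (f j x) (W x) ≤ L * r j := fun j x =>
    (ρ j).dist_normed_convolution_le hW.continuous.aestronglyMeasurable fun y hy =>
      (hW.dist_le_mul y x).trans (mul_le_mul_of_nonneg_left (Metric.mem_ball.1 hy).le hL)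
  have hfc : ∀ j, ContDiff ℝ ∞ (f j) := fun j =>
    HasCompactSupport.contDiff_convolution_left _ (ρ j).hasCompactSupport_normed
      (ρ j).contDiff_normed hW.continuous.locallyIntegrable
  have hfL : ∀ j, LipschitzWith L (f j) := fun j => hW.normed_convolution (ρ j)
  have hfdiff : ∀ j x, DifferentiableAt ℝ (f j) x := fun j x =>
    (hfc j).differentiable (by simp) x
  have hflim : ∀ x, Tendsto (fun j => f j x) atTop (𝓝 (W x)) := fun x => by
    rw [tendsto_iff_dist_tendsto_zero]
    refine squeeze_zero (fun j => dist_nonneg) (fun j => hfd j x) ?_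
    simpa using hr0.const_mul (L : ℝ)
  let φ : ℕ → Plane → ℝ := fun j =>
    Ω.indicator fun x => χ j x * Real.smoothTransition (f j x - (k + δ))
  have hφ : ∀ j, IsTestFunction Ω (φ j) := fun j =>
    isTestFunction_indicator hΩ hδ hW.continuous hWk (hfc j) (fun x => by
      have := (Real.dist_eq _ _ ▸ hfd j x)
      linarith [(abs_le.1 this).2, hrL j]) (hχ j) (hχc j)
  have hφΩ : ∀ j, ∀ x ∈ Ω,
      φ j =ᶠ[𝓝 x] fun x => χ j x * Real.smoothTransition (f j x - (k + δ)) := by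
    intro j x hx
    filter_upwards [hΩ.mem_nhds hx] with y hy
    simp [φ, hy]
  have hgc : ∀ j, Continuous (∇ (φ j)) := fun j => (hφ j).continuous_gradient
  have hSf : ∀ j x, ‖∇ (fun x => Real.smoothTransition (f j x - (k + δ))) x‖ ≤ M * L := by
    intro j x
    rw [(hasGradientAt_smoothTransition_comp (hfdiff j x) _).gradient, norm_smul,
      norm_gradient_eq_norm_fderiv]
    exact mul_le_mul (hM _) (norm_fderiv_le_of_lipschitz ℝ (hfL j)) (norm_nonneg _) M.2
  have hbound : ∀ j, ∀ᵐ x ∂(volume.restrict Ω), ‖∇ (φ j) x‖ ≤ M * L + C := by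
    intro j
    filter_upwards [ae_restrict_mem hΩ.measurableSet] with x hx
    have hSd : DifferentiableAt ℝ (fun x => Real.smoothTransition (f j x - (k + δ))) x :=
      (hasGradientAt_smoothTransition_comp (hfdiff j x) _).differentiableAt
    rw [(hφΩ j x hx).gradient_eq, norm_gradient_eq_norm_fderiv,
      fderiv_fun_mul ((hχ j).differentiable (by simp) x) hSd]
    refine (norm_add_le _ _).trans (add_le_add ?_ ?_)
    · rw [norm_smul, ← norm_gradient_eq_norm_fderiv]
      exact (mul_le_of_le_one_left (norm_nonneg _) (hχ1 j x)).trans (hSf j x)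
    · rw [norm_smul, Real.norm_of_nonneg (Real.smoothTransition.nonneg _)]
      exact (mul_le_of_le_one_left (norm_nonneg _) (Real.smoothTransition.le_one _)).trans
        (norm_fderiv_le_of_lipschitz ℝ (hχC j))
  have hGi : Integrable (Ω.indicator G) volume :=
    (integrable_indicator_iff hΩ.measurableSet).2 (hGp.integrable hp)
  have hconv := ContDiffBump.ae_convolution_tendsto_right_of_locallyIntegrable (φ := ρ)
    (l := atTop) (K := 2) hr0 (Eventually.of_forall fun j => by
      change r j ≤ 2 * (r j / 2)
      linarith) hGi.locallyIntegrable
  have hlim : ∀ᵐ x ∂(volume.restrict Ω), Tendsto (fun j => ∇ (φ j) x) atTop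
      (𝓝 (deriv Real.smoothTransition (W x - (k + δ)) • G x)) := by
    filter_upwards [ae_restrict_mem hΩ.measurableSet, ae_restrict_of_ae hconv] with x hx hcx
    rw [Set.indicator_of_mem hx] at hcx
    have h1 := ((hS'.tendsto _).comp ((hflim x).sub_const (k + δ))).smul hcx
    refine h1.congr' ?_
    obtain ⟨ε, hε, hεΩ⟩ := Metric.isOpen_iff.1 hΩ x hx
    filter_upwards [hχlim x, hr0.eventually_lt_const hε] with j hj hjε
    have hb : Metric.closedBall x (ρ j).rOut ⊆ Ω :=
      (Metric.closedBall_subset_ball hjε).trans hεΩ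
    have h2 : φ j =ᶠ[𝓝 x] fun x => Real.smoothTransition (f j x - (k + δ)) := by
      filter_upwards [hφΩ j x hx, hj] with y hy hy1
      rw [hy, hy1, one_mul]
    rw [h2.gradient_eq, (hasGradientAt_smoothTransition_comp (hfdiff j x) _).gradient,
      gradient_normed_convolution hΩ.measurableSet hW.continuous hG hb]
    rfl
  refine IsTestPair.of_tendsto hΩv hp hA (fun j => (hφ j).isTestPair (hAφ _ (hφ j)))
    (fun j => (hφ j).1.continuous.aestronglyMeasurable)
    (fun j => MemLp.of_bound (hgc j).aestronglyMeasurable _ (hbound j))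
    (memLp_deriv_smoothTransition_smul hW.continuous.aestronglyMeasurable hGp _) ?_
    (tendsto_eLpNorm_sub_of_dominated (zero_lt_one.trans_le hp).ne' hp'
      (fun j => (hgc j).aestronglyMeasurable) (memLp_const _) hbound hlim)
  filter_upwards [ae_restrict_mem hΩ.measurableSet] with x hx
  have h1 := (Real.smoothTransition.continuous.tendsto _).comp ((hflim x).sub_const (k + δ))
  refine h1.congr' ?_
  filter_upwards [hχlim x] with j hj
  rw [(hφΩ j x hx).eq_of_nhds, hj.eq_of_nhds, one_mul]
  rfl

/-! ### Weak gradients and passage to Sobolev functions -/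

theorem IsTestFunction.integrable_smul {Ω : Set Plane} {φ : Plane → ℝ} (hφ : IsTestFunction Ω φ)
    {G : Plane → Plane} (hG : LocallyIntegrableOn G Ω volume) :
    Integrable (fun x => φ x • G x) volume := by
  rw [← integrableOn_iff_integrable_of_support_subset (s := tsupport φ)]
  · exact (hG.integrableOn_compact_subset hφ.2.2 hφ.2.1).continuousOn_smul
      hφ.1.continuous.continuousOn hφ.2.1
  · intro x hx
    refine subset_tsupport φ fun h0 => hx ?_
    simp [h0]

theorem IsTestFunction.integrable_smul_gradient {Ω : Set Plane} {φ : Plane → ℝ}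
    (hφ : IsTestFunction Ω φ) {v : Plane → ℝ} (hv : LocallyIntegrableOn v Ω volume) :
    Integrable (fun x => v x • ∇ φ x) volume := by
  rw [← integrableOn_iff_integrable_of_support_subset (s := tsupport φ)]
  · exact (hv.integrableOn_compact_subset hφ.2.2 hφ.2.1).smul_continuousOn
      hφ.continuous_gradient.continuousOn hφ.2.1
  · intro x hx
    refine support_fderiv_subset ℝ fun h0 => hx ?_
    simp [gradient, h0]

/-- This identifies the gradient in the equation with the one in the `W^{1,p}` hypothesis, which are
chosen independently. -/
theorem HasWeakGradient.ae_eq {Ω : Set Plane} (hΩ : IsOpen Ω) {v : Plane → ℝ}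
    {G₁ G₂ : Plane → Plane} (h₁ : HasWeakGradient Ω v G₁) (h₂ : HasWeakGradient Ω v G₂) :
    G₁ =ᵐ[volume.restrict Ω] G₂ := by
  have h := hΩ.ae_eq_zero_of_integral_contDiff_smul_eq_zero (h₁.2.1.sub h₂.2.1)
    fun φ hφ hφc hφs => by
      have ht : IsTestFunction Ω φ := ⟨hφ, hφc, hφs⟩
      rw [← setIntegral_eq_integral_of_forall_compl_eq_zero (s := Ω) fun x hx => by
        rw [image_eq_zero_of_notMem_tsupport fun h => hx (hφs h), zero_smul]]
      simp only [Pi.sub_apply, smul_sub]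
      rw [integral_sub (ht.integrable_smul h₁.2.1).integrableOn
        (ht.integrable_smul h₂.2.1).integrableOn]
      have e₁ := h₁.2.2 φ ht
      have e₂ := h₂.2.2 φ ht
      rw [e₁, neg_inj] at e₂
      rw [e₂, sub_self]
  filter_upwards [ae_restrict_of_ae h, ae_restrict_mem hΩ.measurableSet] with x hx hxΩ
  exact sub_eq_zero.1 (hx hxΩ)

theorem HasWeakGradient.sub {Ω : Set Plane} {v w : Plane → ℝ}
    {G H : Plane → Plane} (hv : HasWeakGradient Ω v G) (hw : HasWeakGradient Ω w H) :
    HasWeakGradient Ω (fun x => v x - w x) (fun x => G x - H x) := by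
  refine ⟨hv.1.sub hw.1, hv.2.1.sub hw.2.1, fun φ hφ => ?_⟩
  simp only [sub_smul, smul_sub]
  rw [integral_sub (hφ.integrable_smul_gradient hv.1).integrableOn
      (hφ.integrable_smul_gradient hw.1).integrableOn,
    integral_sub (hφ.integrable_smul hv.2.1).integrableOn
      (hφ.integrable_smul hw.2.1).integrableOn, hv.2.2 φ hφ, hw.2.2 φ hφ]
  abel

theorem HasWeakGradient.congr {Ω : Set Plane} (hΩ : MeasurableSet Ω) {v w : Plane → ℝ}
    {G : Plane → Plane} (hv : HasWeakGradient Ω v G) (h : Set.EqOn v w Ω)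
    (hw : LocallyIntegrableOn w Ω volume) : HasWeakGradient Ω w G := by
  refine ⟨hw, hv.2.1, fun φ hφ => ?_⟩
  rw [← hv.2.2 φ hφ]
  exact setIntegral_congr_fun hΩ fun x hx => by simp only [h hx]

/-- With `W` the Lipschitz approximants, of gradient `G - H`, the gradient error splits as `(S'(W) -
S'(v)) G - S'(W) H`. The first term tends to zero in `L^p` by dominated convergence along an almost
everywhere convergent subsequence, the second because `S'` is bounded and `H → 0`. -/
theorem SobolevBoundaryLE.isTestPair_smoothTransition {Ω : Set Plane} (hΩ : IsOpen Ω)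
    (hΩv : volume Ω < ⊤) {p : ℝ} (hp : 1 < p) {q : ENNReal}
    [ENNReal.HolderTriple q (ENNReal.ofReal p) 1] {A : Plane → Plane}
    (hA : MemLp A q (volume.restrict Ω))
    (hAφ : ∀ φ, IsTestFunction Ω φ → ∫ x in Ω, inner ℝ (A x) (∇ φ x) = 0)
    {v : Plane → ℝ} {k : ℝ} (hv : SobolevBoundaryLE p Ω v k) {G : Plane → Plane}
    (hG : HasWeakGradient Ω v G)
    (hGp : MemLp G (ENNReal.ofReal p) (volume.restrict Ω)) {δ : ℝ} (hδ : 0 < δ) :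
    IsTestPair Ω A (fun x => Real.smoothTransition (v x - (k + δ)))
      (fun x => deriv Real.smoothTransition (v x - (k + δ)) • G x) := by
  obtain ⟨w, H, hwL, hwk, hH, hw0, hH0⟩ := hv
  obtain ⟨M, hM⟩ := exists_abs_deriv_smoothTransition_le
  have hS' : Continuous (deriv Real.smoothTransition) :=
    (Real.smoothTransition.contDiff (n := 1)).continuous_deriv le_rfl
  have hp1 : 1 ≤ ENNReal.ofReal p := by simpa using ENNReal.ofReal_le_ofReal hp.le
  have hp0 : ENNReal.ofReal p ≠ 0 := (zero_lt_one.trans_le hp1).ne'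
  have hvm : AEStronglyMeasurable v (volume.restrict Ω) := hG.1.aestronglyMeasurable
  choose L hL using hwL
  choose W hWL hWw using fun n => (hL n).extend_real
  have hWΩ : ∀ n, Set.EqOn (w n) (W n) Ω := fun n x hx => hWw n (subset_closure hx)
  have hHm : ∀ n, AEStronglyMeasurable (H n) (volume.restrict Ω) :=
    fun n => (hH n).2.1.aestronglyMeasurable
  have hWG : ∀ n, HasWeakGradient Ω (W n) (fun x => G x - H n x) := fun n => by
    refine (hG.sub (hH n)).congr hΩ.measurableSet (fun x hx => ?_)
      ((hWL n).continuous.locallyIntegrable.locallyIntegrableOn _)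
    exact (sub_sub_cancel _ _).trans (hWΩ n hx)
  have hmeas : TendstoInMeasure (volume.restrict Ω) (fun n x => v x - w n x) atTop 0 :=
    tendstoInMeasure_of_tendsto_eLpNorm hp0 (fun n => (hH n).1.aestronglyMeasurable)
      aestronglyMeasurable_zero (by simpa using hw0)
  obtain ⟨ns, hns, hae⟩ := hmeas.exists_seq_tendsto_ae
  -- Finitely many `H n` may have infinite norm; the shift by `N` discards them.
  obtain ⟨N, hN⟩ := eventually_atTop.1 (hH0.eventually_lt_const ENNReal.zero_lt_top)
  let m : ℕ → ℕ := fun j => ns (j + N)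
  have hm : Tendsto m atTop atTop := hns.tendsto_atTop.comp (tendsto_add_atTop_nat N)
  have hHp : ∀ j, MemLp (H (m j)) (ENNReal.ofReal p) (volume.restrict Ω) := fun j =>
    ⟨hHm _, hN _ ((Nat.le_add_left N j).trans (hns.id_le _))⟩
  have hWlim : ∀ᵐ x ∂(volume.restrict Ω),
      Tendsto (fun j => W (m j) x) atTop (𝓝 (v x)) := by
    filter_upwards [hae, ae_restrict_mem hΩ.measurableSet] with x hx hxΩ
    have h1 : Tendsto (fun j => v x - w (m j) x) atTop (𝓝 0) :=
      hx.comp (tendsto_add_atTop_nat N)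
    have h2 := h1.const_sub (v x)
    simp only [sub_sub_cancel, sub_zero] at h2
    exact h2.congr fun j => hWΩ _ hxΩ
  have hpair : ∀ j, IsTestPair Ω A (fun x => Real.smoothTransition (W (m j) x - (k + δ)))
      (fun x => deriv Real.smoothTransition (W (m j) x - (k + δ)) • (G x - H (m j) x)) := fun j =>
    (hWL (m j)).isTestPair_smoothTransition hΩ hΩv hp1 ENNReal.ofReal_ne_top hA hAφ
      (fun x hx => by rw [← hWw (m j) (frontier_subset_closure hx)]; exact hwk _ x hx)
      (hWG _) (hGp.sub (hHp j)) hδ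
  refine IsTestPair.of_tendsto hΩv hp1 hA hpair (fun j => ?_) (fun j => ?_)
    (memLp_deriv_smoothTransition_smul hvm hGp _) ?_ ?_
  · exact (Real.smoothTransition.continuous.comp
      ((hWL _).continuous.sub continuous_const)).aestronglyMeasurable
  · exact memLp_deriv_smoothTransition_smul (hWL _).continuous.aestronglyMeasurable
      (hGp.sub (hHp j)) _
  · filter_upwards [hWlim] with x hx
    exact (Real.smoothTransition.continuous.tendsto _).comp (hx.sub_const (k + δ))
  · have hSm : ∀ j, AEStronglyMeasurable
        (fun x => deriv Real.smoothTransition (W (m j) x - (k + δ))) (volume.restrict Ω) := fun j =>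
      (hS'.comp ((hWL _).continuous.sub continuous_const)).aestronglyMeasurable
    have hSv : AEStronglyMeasurable
        (fun x => deriv Real.smoothTransition (v x - (k + δ))) (volume.restrict Ω) :=
      hS'.comp_aestronglyMeasurable (hvm.sub aestronglyMeasurable_const)
    have h1 : Tendsto (fun j => eLpNorm (fun x =>
        deriv Real.smoothTransition (W (m j) x - (k + δ)) • G x -
          deriv Real.smoothTransition (v x - (k + δ)) • G x)
        (ENNReal.ofReal p) (volume.restrict Ω)) atTop (𝓝 0) := by
      refine tendsto_eLpNorm_sub_of_dominated hp0 ENNReal.ofReal_ne_top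
        (b := fun x => M * ‖G x‖) (fun j => (hSm j).smul hGp.1) (hGp.norm.const_mul _)
        (fun j => Eventually.of_forall fun x => ?_) ?_
      · rw [norm_smul]
        exact mul_le_mul_of_nonneg_right (hM _) (norm_nonneg _)
      · filter_upwards [hWlim] with x hx
        exact ((hS'.tendsto _).comp (hx.sub_const (k + δ))).smul_const (G x)
    have h2 : Tendsto (fun j => eLpNorm (fun x =>
        deriv Real.smoothTransition (W (m j) x - (k + δ)) • H (m j) x)
        (ENNReal.ofReal p) (volume.restrict Ω)) atTop (𝓝 0) := by
      have h3 := ENNReal.Tendsto.const_mul (a := ENNReal.ofReal M) (hH0.comp hm)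
        (Or.inr ENNReal.ofReal_ne_top)
      rw [mul_zero] at h3
      refine tendsto_of_tendsto_of_tendsto_of_le_of_le tendsto_const_nhds h3
        (fun j => zero_le) (fun j => ?_)
      refine eLpNorm_le_mul_eLpNorm_of_ae_le_mul (Eventually.of_forall fun x => ?_) _
      rw [norm_smul]
      exact mul_le_mul_of_nonneg_right (hM _) (norm_nonneg _)
    have h4 := h1.add h2
    rw [add_zero] at h4
    refine tendsto_of_tendsto_of_tendsto_of_le_of_le tendsto_const_nhds h4
      (fun j => zero_le) (fun j => ?_)
    refine le_of_eq_of_le ?_ (eLpNorm_sub_le (((hSm j).smul hGp.1).sub (hSv.smul hGp.1))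
      ((hSm j).smul (hHm _)) hp1)
    congr 1
    ext1 x
    simp only [Pi.sub_apply, smul_sub]
    abel

/-! ### The maximum principle -/

theorem mainTheorem6 (p : ℝ) (hp : 1 < p)
    (Ω : Set Plane) (hΩo : IsOpen Ω) (hΩc : IsConnected Ω) (hΩv : volume Ω < ⊤)
    (u : Plane → Plane) (hu : MemW1pMap p Ω u) (hharm : IsPHarmonicMap p Ω u)
    (i : Fin 2) (k : ℝ) (hk : SobolevBoundaryLE p Ω (fun x => u x i) k) :
    ∀ᵐ x ∂(volume.restrict Ω), u x i ≤ k := by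
  choose hup G hG hGp using hu
  obtain ⟨Du, hDu, hweak⟩ := hharm
  have hGD : ∀ j, Du j =ᵐ[volume.restrict Ω] G j := fun j => (hDu j).2.2.ae_eq hΩo (hG j)
  set J : Plane → ℝ := jacobiNorm G with hJ
  have hJ0 : ∀ x, 0 ≤ J x := fun x => Real.sqrt_nonneg _
  have hle : ∀ j x, ‖G j x‖ ≤ J x := fun j x => by
    refine Real.le_sqrt_of_sq_le ?_
    fin_cases j
    · exact le_add_of_nonneg_right (sq_nonneg _)
    · exact le_add_of_nonneg_left (sq_nonneg _)
  have hJm : AEStronglyMeasurable J (volume.restrict Ω) :=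
    Real.continuous_sqrt.comp_aestronglyMeasurable
      (((hGp 0).1.norm.pow 2).add ((hGp 1).1.norm.pow 2))
  have hJp : MemLp J (ENNReal.ofReal p) (volume.restrict Ω) := by
    refine ((hGp 0).norm.add (hGp 1).norm).mono hJm (Eventually.of_forall fun x => ?_)
    rw [Real.norm_of_nonneg (hJ0 x)]
    refine le_trans ?_ (Real.le_norm_self _)
    refine Real.sqrt_le_iff.2 ⟨add_nonneg (norm_nonneg _) (norm_nonneg _), ?_⟩
    simp only [Pi.add_apply]
    nlinarith [norm_nonneg (G 0 x), norm_nonneg (G 1 x)]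
  let A : Plane → Plane := fun x => J x ^ (p - 2) • G i x
  have hAm : AEStronglyMeasurable A (volume.restrict Ω) :=
    (hJm.aemeasurable.pow_const (p - 2)).aestronglyMeasurable.smul (hGp i).1
  have hconj : p.HolderConjugate (p / (p - 1)) := Real.HolderConjugate.conjExponent hp
  -- `|A| ≤ J^(p-1)`, and `J ∈ L^p` puts the bound in the conjugate space. Where `J = 0` the power
  -- `J^(p-2)` is irrelevant, because `G i` vanishes there.
  have hA : MemLp A (ENNReal.ofReal (p / (p - 1))) (volume.restrict Ω) := by
    have h1 := hJp.norm_rpow_div (ENNReal.ofReal (p - 1))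
    rw [← ENNReal.ofReal_div_of_pos (by linarith), ENNReal.toReal_ofReal (by linarith)] at h1
    refine h1.mono hAm (Eventually.of_forall fun x => ?_)
    rw [Real.norm_of_nonneg (Real.rpow_nonneg (norm_nonneg _) _), Real.norm_of_nonneg (hJ0 x),
      norm_smul, Real.norm_of_nonneg (Real.rpow_nonneg (hJ0 x) _)]
    rcases (hJ0 x).eq_or_lt with h0 | h0
    · have : ‖G i x‖ = 0 := le_antisymm ((hle i x).trans_eq h0.symm) (norm_nonneg _)
      rw [this, mul_zero]
      exact Real.rpow_nonneg (hJ0 x) _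
    · calc J x ^ (p - 2) * ‖G i x‖ ≤ J x ^ (p - 2) * J x :=
            mul_le_mul_of_nonneg_left (hle i x) (Real.rpow_nonneg (hJ0 x) _)
        _ = J x ^ (p - 1) := by
            rw [← Real.rpow_add_one h0.ne']
            congr 1
            ring
  have hAφ : ∀ φ, IsTestFunction Ω φ → ∫ x in Ω, inner ℝ (A x) (∇ φ x) = 0 := by
    intro φ hφ
    rw [← hweak i φ hφ]
    refine integral_congr_ae ?_
    filter_upwards [hGD 0, hGD 1, hGD i] with x h0 h1 hi
    simp only [A, hJ, jacobiNorm, h0, h1, hi, real_inner_smul_left]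
  have : ENNReal.HolderTriple (ENNReal.ofReal (p / (p - 1))) (ENNReal.ofReal p) 1 :=
    hconj.symm.ennrealOfReal
  have hmono : ∀ t, 0 ≤ deriv Real.smoothTransition t := fun t =>
    Real.smoothTransition.monotone.deriv_nonneg
  have hδ : ∀ n : ℕ, ∀ᵐ x ∂(volume.restrict Ω), u x i ≤ k + 1 / ((n : ℝ) + 1) := by
    intro n
    have hpos : (0 : ℝ) < 1 / ((n : ℝ) + 1) := by positivity
    obtain ⟨horth, hsob⟩ := hk.isTestPair_smoothTransition hΩo hΩv hp hA hAφ (hG i) (hGp i) hpos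
    set c := k + 1 / ((n : ℝ) + 1)
    have hF := memLp_deriv_smoothTransition_smul (hup i).1 (hGp i) c
    have hnn : ∀ x, 0 ≤ inner ℝ (A x) (deriv Real.smoothTransition (u x i - c) • G i x) := by
      intro x
      rw [real_inner_smul_left, real_inner_smul_right, real_inner_self_eq_norm_sq]
      exact mul_nonneg (Real.rpow_nonneg (hJ0 x) _) (mul_nonneg (hmono _) (sq_nonneg _))
    have hzero := (integral_eq_zero_iff_of_nonneg hnn (hA.integrable_real_inner hF)).1 horth
    have hF0 : (fun x => deriv Real.smoothTransition (u x i - c) • G i x)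
        =ᵐ[volume.restrict Ω] 0 := by
      filter_upwards [hzero] with x hx
      rw [Pi.zero_apply, real_inner_smul_left, real_inner_smul_right,
        real_inner_self_eq_norm_sq] at hx
      rw [Pi.zero_apply, smul_eq_zero]
      rcases (hJ0 x).eq_or_lt with h0 | h0
      · right
        exact norm_le_zero_iff.1 ((hle i x).trans_eq h0.symm)
      · rcases mul_eq_zero.1 hx with h | h
        · exact absurd h (Real.rpow_pos_of_pos h0 _).ne'
        · simpa using h
    have hSm : AEStronglyMeasurable (fun x => Real.smoothTransition (u x i - c))
        (volume.restrict Ω) := Real.smoothTransition.continuous.comp_aestronglyMeasurable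
      ((hup i).1.sub aestronglyMeasurable_const)
    -- With zero gradient, the Sobolev inequality makes the truncation itself zero almost
    -- everywhere.
    rw [eLpNorm_congr_ae hF0, eLpNorm_zero, mul_zero, nonpos_iff_eq_zero,
      eLpNorm_eq_zero_iff hSm two_ne_zero] at hsob
    filter_upwards [hsob] with x hx
    have := Real.smoothTransition.zero_iff_nonpos.1 hx
    linarith
  filter_upwards [ae_all_iff.2 hδ] with x hx
  refine ge_of_tendsto' (x := atTop) ?_ hx
  simpa using tendsto_one_div_add_atTop_nhds_zero_nat.const_add k
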